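/- **Lemma.** Let $m,d$ be nonnegative integers, let $\Theta\subset\mathbb R^m$ be compact and convex, let $g:\mathbb R^m\times\mathbb R^d\to\mathbb R$, and put $\mathcal S(\theta)=\arg\min_{x\in\mathbb R^d}g(\theta,x)$. All norms are Euclidean, and $\partial_\theta,\partial_x$ denote gradients in the first and second argument. *The condition PL° with constant $\mu>0$.* A function $h:\mathbb R^d\to\mathbb R$ with set of local minimizers $\mathcal M$ satisfies it if 1. $h$ is $\mathcal C^2$, and every connected component $\mathcal M'$ of $\mathcal M$ has an open neighbourhood $\mathcal N(\mathcal M')\supseteq\mathcal M'$ on which $h$ is $\mathcal C^4$, attains its minimum over $\mathcal N(\mathcal M')$, and satisfies $h(x)-\min_{\mathcal N(\mathcal M')}h\le\frac1{2\mu}\|\nabla h(x)\|^2$ for all $x\in\mathcal N(\mathcal M')$; 2. with these same neighbourhoods, if $x\notin\bigcup_{\mathcal M'}\mathcal N(\mathcal M')$ and $\nabla h(x)=0$, then $\nabla^2h(x)$ is negative definite; 3. $\mathcal M$ is contained in a compact set. *Assumptions.* There are constants $\mu>0$, $L_{g,2}\in\mathbb R$, $C_g,D_g\ge0$, an integer $\mathsf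 n_g\ge1$, $\mu_{\mathsf{qg}}>0$ and $\mathsf D>0$, all independent of $\theta$, such that for all $\theta\in\Theta$: - $g(\theta,\cdot)$ satisfies PL° with constant $\mu$; - $g$ is jointly $\mathcal C^2$ near every point of $\{\theta\}\times\mathbb R^d$, and $\|\partial_\theta g(\theta,x)\|\le C_g\|x\|^{\mathsf n_g}+D_g$ for all $x\in\mathbb R^d$; - $\|\partial_xg(\theta,x)-\partial_xg(\theta',x)\|\le L_{g,2}\|\theta-\theta'\|$ for all $\theta'\in\Theta$ and all $x$ with $\|x\|\le\mathsf D$ (in particular this holds if it holds for all $x\in\mathbb R^d$); - the Hessian $\partial_x^2g$ is continuous in $(\theta,x)$ on $\Theta\times\mathbb R^d$; - $\mathcal S(\theta)$ is nonempty and contained in the closed ball of radius $\mathsf D$ about $0$, and $\frac{\mu_{\mathsf{qg}}}2\operatorname{dist}(x,\mathcal S(\theta))^2\le g(\theta,x)-\min_zg(\theta,z)$ whenever $\|x\|\ge\mathsf D$; - if $d=1$, the set $\mathcal S(\theta)$ is connected. *Conclusion.* There is $\gamma>0$ such that for all $\theta_1,\theta_2\in\Theta$ with $\|\theta_1-\theta_2\|\le\gamma$,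 $$\operatorname{dist}_H\bigl(\mathcal S(\theta_1),\mathcal S(\theta_2)\bigr)\le\frac{L_{g,2}}{\mu}\,\|\theta_1-\theta_2\|,$$ where $\operatorname{dist}_H$ is the Hausdorff distance. -/

import Mathlib

/-- The set of global minimizers of `h`. -/
def argminSet {E : Type*} (h : E → ℝ) : Set E :=
  {x | ∀ z, h x ≤ h z}

/-- The set of all local minimizers of `h`. -/
def localMinSet {E : Type*} [TopologicalSpace E] (h : E → ℝ) : Set E :=
  {x | IsLocalMin h x}

/-- The connected components of a set `M`. -/
def componentsOf {E : Type*} [TopologicalSpace E] (M : Set E) : Set (Set E) :=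
  {C | ∃ x ∈ M, C = connectedComponentIn M x}

/-- The Polyak–Łojasiewicz inequality with constant `μ` on the set `N`:
`h x - min_N h ≤ (2 μ)⁻¹ ‖∇ h x‖ ^ 2` for all `x ∈ N`, the minimum being attained. -/
def PLOn {d : ℕ} (μ : ℝ) (h : EuclideanSpace ℝ (Fin d) → ℝ)
    (N : Set (EuclideanSpace ℝ (Fin d))) : Prop :=
  ∃ m : ℝ, IsLeast (h '' N) m ∧ ∀ x ∈ N, h x - m ≤ (2 * μ)⁻¹ * ‖gradient h x‖ ^ 2

/-- The PL° condition with constant `μ`. The function `N` assigns to every connected component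
of the set of local minimizers its neighbourhood; the same neighbourhoods are used in the local
PL inequality, in the `C⁴` condition and in the condition on the other critical points. -/
def IsPLCirc {d : ℕ} (μ : ℝ) (h : EuclideanSpace ℝ (Fin d) → ℝ) : Prop :=
  ContDiff ℝ 2 h ∧
  (∃ N : Set (EuclideanSpace ℝ (Fin d)) → Set (EuclideanSpace ℝ (Fin d)),
    (∀ C ∈ componentsOf (localMinSet h),
      IsOpen (N C) ∧ C ⊆ N C ∧ PLOn μ h (N C) ∧ ContDiffOn ℝ 4 h (N C)) ∧
    (∀ x, x ∉ (⋃ C ∈ componentsOf (localMinSet h), N C) → gradient h x = 0 →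
      ∀ v, v ≠ 0 → fderiv ℝ (fderiv ℝ h) x v v < 0)) ∧
  ∃ K : Set (EuclideanSpace ℝ (Fin d)), IsCompact K ∧ localMinSet h ⊆ K

/-- Regularity of the lower-level objective `g θ x` over the parameter set `Θ`. -/
structure LowerLevelRegular {m d : ℕ} (Θ : Set (EuclideanSpace ℝ (Fin m)))
    (g : EuclideanSpace ℝ (Fin m) → EuclideanSpace ℝ (Fin d) → ℝ)
    (L Cg Dg : ℝ) (ng : ℕ) (μqg D : ℝ) : Prop where
  /-- `g` is jointly `C²` (in a neighbourhood of each point of `Θ × ℝᵈ`). -/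
  contDiff : ∀ θ ∈ Θ, ∀ x, ContDiffAt ℝ 2 (fun p : EuclideanSpace ℝ (Fin m) ×
    EuclideanSpace ℝ (Fin d) => g p.1 p.2) (θ, x)
  /-- Smoothness with respect to `θ`: the gradient `∂ₓ g (θ, x)` is `L`-Lipschitz in `θ`. -/
  smooth : ∀ x, ‖x‖ ≤ D → ∀ θ₁ ∈ Θ, ∀ θ₂ ∈ Θ,
    ‖gradient (g θ₁) x - gradient (g θ₂) x‖ ≤ L * ‖θ₁ - θ₂‖
  /-- Polynomial growth of `∂_θ g`. -/
  growth : ∀ θ ∈ Θ, ∀ x, ‖gradient (fun θ' => g θ' x) θ‖ ≤ Cg * ‖x‖ ^ ng + Dg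
  /-- The Hessian in `x` is continuous in `(θ, x)`. -/
  hessian_cont : ContinuousOn (fun p : EuclideanSpace ℝ (Fin m) × EuclideanSpace ℝ (Fin d) =>
    fderiv ℝ (fderiv ℝ (g p.1)) p.2) (Θ ×ˢ Set.univ)
  /-- The lower-level minimum is attained. -/
  nonempty : ∀ θ ∈ Θ, (argminSet (g θ)).Nonempty
  /-- The minimizers lie in the closed ball of radius `D`. -/
  subset_ball : ∀ θ ∈ Θ, argminSet (g θ) ⊆ Metric.closedBall 0 D
  /-- Quadratic growth outside that ball (`z` is any minimizer, `g θ z` the minimum). -/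
  quadratic_growth : ∀ θ ∈ Θ, ∀ x, D ≤ ‖x‖ → ∀ z ∈ argminSet (g θ),
    μqg * Metric.infDist x (argminSet (g θ)) ^ 2 / 2 ≤ g θ x - g θ z

/-! The estimate is infinitesimal and is then integrated. At a global minimizer, PL forces the
nonzero Hessian eigenvalues to be at least `μ`. It also makes the displacement to any point whose
closest minimizer it is orthogonal to the Hessian kernel. Uniform continuity of the Hessian on a
compact set then gives `(μ - ω) * dist(x, S(θ)) ≤ ‖∂ₓg(θ, x)‖` on a tube of radius `r` independent
of `θ` (`exists_error_bound`), although the PL neighbourhoods may shrink as `θ` varies.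

A minimizer for `θ` has gradient at most `L * ‖θ - θ₀‖` for `θ₀`, and conversely, so inside the tube
it is `L / (μ - ω) * ‖θ - θ₀‖`-close to the other solution set. Upper semicontinuity puts `S(θ)` in
the tube of `S(θ₀)`. In the other direction distances to `S(θ)` cannot lie strictly between this
small bound and `r`, so connectedness of `S(θ₀)` keeps all of it close. For `d ≥ 2` connectedness is
a mountain pass argument: a pass between two pieces would be a critical point that is neither a
local minimizer nor a strict local maximizer.

Letting `ω` tend to zero bounds the pointwise Lipschitz constant by `L / μ`, and convexity of `Θ`
allows integration along segments without loss. -/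

section

open Filter Topology Set Metric

/-! ### Second-order consequences of PL and the error bound -/

/-- First-order condition at a local minimizer of `f + c * dist · x`. -/
theorem norm_fderiv_le_of_isLocalMin_add_dist {E : Type*} [NormedAddCommGroup E] [NormedSpace ℝ E]
    {f : E → ℝ} {f' : E →L[ℝ] ℝ} {x z : E} {c : ℝ} (hc : 0 ≤ c) (hf : HasFDerivAt f f' z)
    (hmin : IsLocalMin (fun w => f w + c * dist w x) z) : ‖f'‖ ≤ c := by
  have key : ∀ v, -(c * ‖v‖) ≤ f' v := by
    intro v
    have hline : HasDerivAt (fun t : ℝ => z + t • v) v 0 := by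
      simpa using ((hasDerivAt_id (0 : ℝ)).smul_const v).const_add z
    have hcomp : HasDerivAt (fun t : ℝ => f (z + t • v)) (f' v) 0 := by
      have hf0 : HasFDerivAt f f' (z + (0 : ℝ) • v) := by simpa using hf
      exact hf0.comp_hasDerivAt 0 hline
    have htot : HasDerivAt (fun t : ℝ => f (z + t • v) + c * (t * ‖v‖)) (f' v + c * ‖v‖) 0 := by
      have := hcomp.add (((hasDerivAt_id (0 : ℝ)).mul_const ‖v‖).const_mul c)
      rw [one_mul] at this
      exact this
    have htend : Tendsto (fun t : ℝ => z + t • v) (𝓝 0) (𝓝 z) := by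
      simpa using hline.continuousAt.tendsto
    -- Only `t ≥ 0` is usable: there the penalty grows by at most `t * ‖v‖`.
    have hlm : IsLocalMinOn (fun t : ℝ => f (z + t • v) + c * (t * ‖v‖)) (Ici 0) 0 := by
      filter_upwards [(htend.eventually hmin).filter_mono nhdsWithin_le_nhds,
        self_mem_nhdsWithin] with t ht ht0
      have h1 : dist (z + t • v) x ≤ dist z x + t * ‖v‖ := by
        calc dist (z + t • v) x ≤ dist (z + t • v) z + dist z x := dist_triangle _ _ _
          _ = dist z x + t * ‖v‖ := by
            rw [dist_eq_norm, add_sub_cancel_left, norm_smul, Real.norm_of_nonneg ht0, add_comm]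
      have h2 := mul_le_mul_of_nonneg_left h1 hc
      simp only [zero_smul, add_zero, zero_mul, mul_zero]
      linarith
    have := hlm.hasFDerivWithinAt_nonneg htot.hasFDerivAt.hasFDerivWithinAt
      (y := 1) (mem_posTangentConeAt_of_segment_subset (by
        rw [zero_add, segment_eq_Icc zero_le_one]; exact Icc_subset_Ici_self))
    simp at this
    linarith
  refine ContinuousLinearMap.opNorm_le_bound _ hc fun v => ?_
  rw [Real.norm_eq_abs, abs_le]
  refine ⟨key v, ?_⟩
  have := key (-v)
  rw [map_neg, norm_neg] at this
  linarith

/-- A Polyak–Łojasiewicz inequality on a ball yields a nearby minimizer. -/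
theorem exists_minimizer_near_of_PL {E : Type*} [NormedAddCommGroup E] [NormedSpace ℝ E]
    [ProperSpace E] {h : E → ℝ} {m μ c R : ℝ} {p x : E} (hdiff : Differentiable ℝ h)
    (hm : ∀ z, m ≤ h z) (hPL : ∀ z ∈ ball p R, 2 * μ * (h z - m) ≤ ‖fderiv ℝ h z‖ ^ 2)
    (hc : 0 < c) (hcμ : 2 * c ^ 2 < μ) (hx : c * dist x p + √(h x - m) < c * R) :
    ∃ z, h z = m ∧ c * dist z x ≤ √(h x - m) := by
  set f : E → ℝ := fun z => √(h z - m) with hfdef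
  have hfc : Continuous f := (hdiff.continuous.sub continuous_const).sqrt
  have hfx : 0 ≤ f x := Real.sqrt_nonneg _
  set ρ := f x / c with hρ
  have hρ0 : 0 ≤ ρ := by positivity
  have hcρ : c * ρ = f x := by rw [hρ]; field_simp
  -- The slack over `ρ` makes the constrained minimizer interior to its ball, while that ball stays
  -- in the PL region.
  obtain ⟨ρ', h1, h2⟩ : ∃ ρ', ρ < ρ' ∧ c * dist x p + c * ρ' < c * R := by
    refine ⟨ρ + (R - dist x p - ρ) / 2, ?_, ?_⟩
    all_goals
      have : 0 < R - dist x p - ρ := by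
        have : c * (dist x p + ρ) < c * R := by rw [mul_add, hcρ]; exact hx
        have := lt_of_mul_lt_mul_left this hc.le
        linarith
    · linarith
    · have := mul_pos hc this
      nlinarith
  obtain ⟨z, hzB, hz⟩ := (isCompact_closedBall x ρ').exists_isMinOn
    ⟨x, mem_closedBall_self (hρ0.trans h1.le)⟩
    (hfc.add (continuous_const.mul (continuous_id.dist continuous_const)) :
      Continuous fun w => f w + c * dist w x).continuousOn
  have hzx : f z + c * dist z x ≤ f x := by
    simpa using hz (mem_closedBall_self (hρ0.trans h1.le))
  have hfz : 0 ≤ f z := Real.sqrt_nonneg _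
  refine ⟨z, ?_, by linarith⟩
  -- Where `h > m`, PL makes the slope of `√(h - m)` at least `√(μ / 2) > c`, whereas penalized
  -- minimality bounds it by `c`.
  by_contra hne
  have hpos : 0 < h z - m := sub_pos.2 ((hm z).lt_of_ne (Ne.symm hne))
  have hzρ : dist z x < ρ' := by
    have : c * dist z x ≤ c * ρ := by linarith
    exact (le_of_mul_le_mul_left this hc).trans_lt h1
  have hloc : IsLocalMin (fun w => f w + c * dist w x) z :=
    hz.isLocalMin (mem_of_superset (isOpen_ball.mem_nhds (mem_ball.2 hzρ)) ball_subset_closedBall)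
  have hder : HasFDerivAt f ((1 / (2 * f z)) • fderiv ℝ h z) z :=
    ((hdiff z).hasFDerivAt.sub_const m).sqrt hpos.ne'
  have hle := norm_fderiv_le_of_isLocalMin_add_dist hc.le hder hloc
  have hfz' : 0 < f z := Real.sqrt_pos.2 hpos
  have hsq : f z ^ 2 = h z - m := Real.sq_sqrt hpos.le
  rw [norm_smul, Real.norm_of_nonneg (by positivity), one_div, inv_mul_le_iff₀ (by positivity)] at hle
  have hzp : z ∈ ball p R := by
    have h3 : c * dist z p ≤ c * dist z x + c * dist x p := by
      rw [← mul_add]; exact mul_le_mul_of_nonneg_left (dist_triangle _ _ _) hc.le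
    have h4 : c * dist z x < c * ρ' := mul_lt_mul_of_pos_left hzρ hc
    exact lt_of_mul_lt_mul_left (by linarith) hc.le
  have h5 := hPL z hzp
  have h6 : ‖fderiv ℝ h z‖ ^ 2 ≤ (2 * f z * c) ^ 2 := pow_le_pow_left₀ (norm_nonneg _) hle 2
  have h7 : 2 * f z ^ 2 * (2 * c ^ 2) < 2 * f z ^ 2 * μ := by gcongr
  nlinarith

/-- The displacement from a set of minimizers satisfying a local Polyak–Łojasiewicz inequality to a
point is normal to the kernel of the Hessian at the closest minimizer. -/
theorem inner_nonpos_of_closest_of_PL {E : Type*} [NormedAddCommGroup E] [InnerProductSpace ℝ E]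
    [FiniteDimensional ℝ E] {h : E → ℝ} {μ : ℝ} {p x v : E} (hμ : 0 < μ) (hC : ContDiff ℝ 2 h)
    (hp : p ∈ argminSet h)
    (hPL : ∀ᶠ z in 𝓝 p, 2 * μ * (h z - h p) ≤ ‖fderiv ℝ h z‖ ^ 2)
    (hclosest : ∀ z ∈ argminSet h, dist x p ≤ dist x z)
    (hv : fderiv ℝ (fderiv ℝ h) p v = 0) : inner ℝ (x - p) v ≤ 0 := by
  have hdiff : Differentiable ℝ h := hC.differentiable (by norm_num)
  have hdiff2 : Differentiable ℝ (fderiv ℝ h) :=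
    (hC.fderiv_right (m := 1) (by norm_num)).differentiable (by norm_num)
  have hcrit : fderiv ℝ h p = 0 := IsLocalMin.fderiv_eq_zero (Eventually.of_forall hp)
  obtain ⟨R, hR, hball⟩ := Metric.eventually_nhds_iff_ball.1 hPL
  set c : ℝ := √(μ / 4) with hcdef
  have hc : 0 < c := Real.sqrt_pos.2 (by positivity)
  have hc2 : c ^ 2 = μ / 4 := Real.sq_sqrt (by positivity)
  set ρ := ‖x - p‖ with hρ
  -- the derivative along `v` is small
  have hline : HasDerivAt (fun t : ℝ => p + t • v) v 0 := by
    simpa using ((hasDerivAt_id (0 : ℝ)).smul_const v).const_add p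
  have hder : HasDerivAt (fun t : ℝ => fderiv ℝ h (p + t • v)) 0 0 := by
    have h0 : HasFDerivAt (fderiv ℝ h) (fderiv ℝ (fderiv ℝ h) p) (p + (0 : ℝ) • v) := by
      simpa using (hdiff2 p).hasFDerivAt
    have := h0.comp_hasDerivAt 0 hline
    rw [hv] at this
    exact this
  have hsmall : ∀ ε > 0, ∀ᶠ t : ℝ in 𝓝[>] 0, ‖fderiv ℝ h (p + t • v)‖ ≤ ε * t := by
    intro ε hε
    have := (hasDerivAt_iff_isLittleO.1 hder).def hε
    filter_upwards [this.filter_mono nhdsWithin_le_nhds, self_mem_nhdsWithin] with t ht ht0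
    simpa [hcrit, abs_of_pos (show (0:ℝ) < t from ht0)] using ht
  -- Along a kernel direction the gradient is `o(t)`, so by PL the gap is `o(t²)` and a minimizer
  -- lies within `o(t)` of `p + t • v`. It is no closer to `x` than `p` is; squaring and keeping
  -- first order in `t` yields the sign of the inner product.
  have hdist : ∀ ε > 0, ∀ᶠ t : ℝ in 𝓝[>] 0, ρ ≤ ‖x - p - t • v‖ + ε * t := by
    intro ε hε
    have htend : Tendsto (fun t : ℝ => c * dist (p + t • v) p + √(h (p + t • v) - h p)) (𝓝 0)
        (𝓝 0) := by
      have hcont : Continuous fun t : ℝ => c * dist (p + t • v) p + √(h (p + t • v) - h p) := by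
        have := hdiff.continuous
        fun_prop
      simpa using hcont.tendsto 0
    have htend' : Tendsto (fun t : ℝ => p + t • v) (𝓝 0) (𝓝 p) := by
      simpa using hline.continuousAt.tendsto
    filter_upwards [(htend.eventually_lt_const (mul_pos hc hR)).filter_mono nhdsWithin_le_nhds,
      hsmall (ε * μ / 2) (by positivity), (htend'.eventually hPL).filter_mono nhdsWithin_le_nhds,
      self_mem_nhdsWithin] with t ht hts htPL ht0
    have ht0 : 0 < t := ht0
    obtain ⟨z, hz, hzd⟩ := exists_minimizer_near_of_PL hdiff hp hball hc
      (by rw [hc2]; linarith) ht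
    have hzS : z ∈ argminSet h := fun w => hz ▸ hp w
    have hsq : h (p + t • v) - h p ≤ (c * (ε * t)) ^ 2 := by
      have h1 : ‖fderiv ℝ h (p + t • v)‖ ^ 2 ≤ (ε * μ / 2 * t) ^ 2 :=
        pow_le_pow_left₀ (norm_nonneg _) hts 2
      have h2 : μ * (2 * (h (p + t • v) - h p)) ≤ μ * (μ * (ε * t) ^ 2 / 4) := by nlinarith
      have h3 := le_of_mul_le_mul_left h2 hμ
      have h4 : 0 ≤ μ * (ε * t) ^ 2 := by positivity
      rw [mul_pow, hc2]
      linarith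
    have h4 : √(h (p + t • v) - h p) ≤ c * (ε * t) := Real.sqrt_le_iff.2 ⟨by positivity, hsq⟩
    have h5 : dist z (p + t • v) ≤ ε * t := le_of_mul_le_mul_left (hzd.trans h4) hc
    calc ρ = dist x p := (dist_eq_norm _ _).symm
      _ ≤ dist x z := hclosest z hzS
      _ ≤ dist x (p + t • v) + dist (p + t • v) z := dist_triangle _ _ _
      _ ≤ ‖x - p - t • v‖ + ε * t := by
        rw [dist_eq_norm x, sub_sub, dist_comm _ z]; gcongr
  have hfin : ∀ ε > 0, ∀ᶠ t : ℝ in 𝓝[>] 0, 2 * inner ℝ (x - p) v ≤ 2 * ρ * ε + t * ‖v‖ ^ 2 := by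
    intro ε hε
    filter_upwards [hdist ε hε, self_mem_nhdsWithin] with t ht ht0
    have ht0 : 0 < t := ht0
    have h1 : ‖x - p - t • v‖ ^ 2 = ρ ^ 2 - 2 * (t * inner ℝ (x - p) v) + t ^ 2 * ‖v‖ ^ 2 := by
      rw [norm_sub_sq_real, inner_smul_right, norm_smul, mul_pow, Real.norm_eq_abs, sq_abs]
    have h2 : ρ ^ 2 - 2 * ρ * (ε * t) ≤ ‖x - p - t • v‖ ^ 2 := by
      have hρ0 : 0 ≤ ρ := norm_nonneg _
      have hn : 0 ≤ ‖x - p - t • v‖ := norm_nonneg _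
      have hεt : 0 < ε * t := by positivity
      by_cases hcase : ρ ≤ ε * t
      · nlinarith
      · nlinarith
    have h3 : t * (2 * inner ℝ (x - p) v) ≤ t * (2 * ρ * ε + t * ‖v‖ ^ 2) := by nlinarith
    exact le_of_mul_le_mul_left h3 ht0
  have hlim : ∀ ε > 0, 2 * inner ℝ (x - p) v ≤ 2 * ρ * ε := by
    intro ε hε
    have htend : Tendsto (fun t : ℝ => 2 * ρ * ε + t * ‖v‖ ^ 2) (𝓝[>] 0) (𝓝 (2 * ρ * ε)) := by
      have : Continuous fun t : ℝ => 2 * ρ * ε + t * ‖v‖ ^ 2 := by fun_prop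
      simpa using (this.tendsto 0).mono_left nhdsWithin_le_nhds
    exact ge_of_tendsto htend (hfin ε hε)
  have htend : Tendsto (fun ε : ℝ => 2 * ρ * ε) (𝓝[>] 0) (𝓝 0) := by
    have : Continuous fun ε : ℝ => 2 * ρ * ε := by fun_prop
    simpa using (this.tendsto 0).mono_left nhdsWithin_le_nhds
  have := ge_of_tendsto htend (eventually_mem_nhdsWithin.mono hlim)
  linarith

/-- At a minimizer satisfying a local Polyak–Łojasiewicz inequality, the nonzero eigenvalues of the
Hessian are at least the Polyak–Łojasiewicz constant. -/
theorem eigenvalue_eq_zero_or_le_of_PL {E : Type*} [NormedAddCommGroup E] [InnerProductSpace ℝ E]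
    {h : E → ℝ} {μ l : ℝ} {p v : E} (hμ : 0 < μ) (hC : ContDiff ℝ 2 h)
    (hp : p ∈ argminSet h)
    (hPL : ∀ᶠ z in 𝓝 p, 2 * μ * (h z - h p) ≤ ‖fderiv ℝ h z‖ ^ 2)
    (hv : ‖v‖ = 1) (heig : fderiv ℝ (fderiv ℝ h) p v = l • innerSL ℝ v) : l = 0 ∨ μ ≤ l := by
  have hdiff : Differentiable ℝ h := hC.differentiable (by norm_num)
  have hdiff2 : Differentiable ℝ (fderiv ℝ h) :=
    (hC.fderiv_right (m := 1) (by norm_num)).differentiable (by norm_num)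
  have hcrit : fderiv ℝ h p = 0 := IsLocalMin.fderiv_eq_zero (Eventually.of_forall hp)
  have hline : ∀ s : ℝ, HasDerivAt (fun t : ℝ => p + t • v) v s := fun s => by
    simpa using ((hasDerivAt_id s).smul_const v).const_add p
  have hlineTend : Tendsto (fun t : ℝ => p + t • v) (𝓝 0) (𝓝 p) := by
    simpa using (hline 0).continuousAt.tendsto
  have hder : HasDerivAt (fun t : ℝ => fderiv ℝ h (p + t • v)) (l • innerSL ℝ v) 0 := by
    have h0 : HasFDerivAt (fderiv ℝ h) (fderiv ℝ (fderiv ℝ h) p) (p + (0 : ℝ) • v) := by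
      simpa using (hdiff2 p).hasFDerivAt
    have := h0.comp_hasDerivAt 0 (hline 0)
    rw [heig] at this
    exact this
  have hsmall : ∀ ε > 0, ∀ᶠ t : ℝ in 𝓝[>] 0,
      ‖fderiv ℝ h (p + t • v) - t • l • innerSL ℝ v‖ ≤ ε * t := by
    intro ε hε
    have := (hasDerivAt_iff_isLittleO.1 hder).def hε
    filter_upwards [this.filter_mono nhdsWithin_le_nhds, self_mem_nhdsWithin] with t ht ht0
    simpa [hcrit, abs_of_pos (show (0:ℝ) < t from ht0)] using ht
  have hφ : ∀ s : ℝ, HasDerivAt (fun t : ℝ => h (p + t • v)) (fderiv ℝ h (p + s • v) v) s :=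
    fun s => (hdiff (p + s • v)).hasFDerivAt.comp_hasDerivAt s (hline s)
  have hnormSL : ‖innerSL ℝ v‖ = 1 := by rw [innerSL_apply_norm, hv]
  -- second-order comparison along the eigenvector
  have hbounds : ∀ ε > 0, ∀ᶠ t : ℝ in 𝓝[>] 0, |h (p + t • v) - h p - l * t ^ 2 / 2| ≤ ε * t ^ 2 := by
    intro ε hε
    obtain ⟨δ, hδ, hδt⟩ := mem_nhdsGT_iff_exists_Ioo_subset.1 (hsmall ε hε)
    have hδ : 0 < δ := hδ
    filter_upwards [Ioo_mem_nhdsGT hδ] with t ht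
    have hb : ∀ s ∈ Icc 0 t, ‖fderiv ℝ h (p + s • v) v - l * s‖ ≤ ε * t := by
      intro s hs
      rcases hs.1.eq_or_lt with rfl | hs0
      · simp [hcrit]; nlinarith [ht.1]
      · have h1 := hδt ⟨hs0, hs.2.trans_lt ht.2⟩
        have h2 := (fderiv ℝ h (p + s • v) - s • l • innerSL ℝ v).le_of_opNorm_le h1 v
        have h3 : (fderiv ℝ h (p + s • v) - s • l • innerSL ℝ v) v
            = fderiv ℝ h (p + s • v) v - l * s := by
          simp [hv, mul_comm]
        rw [h3, hv, mul_one] at h2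
        exact h2.trans (mul_le_mul_of_nonneg_left hs.2 hε.le)
    have hd : ∀ s ∈ Icc 0 t, HasDerivWithinAt (fun t : ℝ => h (p + t • v) - l * t ^ 2 / 2)
        (fderiv ℝ h (p + s • v) v - l * s) (Icc 0 t) s := by
      intro s _
      have h1 : HasDerivAt (fun t : ℝ => l * t ^ 2 / 2) (l * s) s := by
        have := (((hasDerivAt_id s).pow 2).const_mul l).div_const 2
        convert! this using 1
        simp; ring
      exact ((hφ s).sub h1).hasDerivWithinAt
    have := (convex_Icc (0 : ℝ) t).norm_image_sub_le_of_norm_hasDerivWithin_le hd hb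
      (left_mem_Icc.2 ht.1.le) (right_mem_Icc.2 ht.1.le)
    simp only [zero_smul, add_zero, Real.norm_eq_abs, sub_zero, abs_of_pos ht.1] at this
    calc |h (p + t • v) - h p - l * t ^ 2 / 2|
        = |h (p + t • v) - l * t ^ 2 / 2 - (h p - l * 0 ^ 2 / 2)| := by congr 1; ring
      _ ≤ ε * t * t := this
      _ = ε * t ^ 2 := by ring
  have hl0 : 0 ≤ l := by
    by_contra! hneg
    obtain ⟨t, ht, ht0⟩ := ((hbounds (-l / 4) (by linarith)).and self_mem_nhdsWithin).exists
    have ht0 : 0 < t := ht0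
    have h1 := hp (p + t • v)
    have h2 := (abs_le.1 ht).2
    have h3 : 0 < t ^ 2 := by positivity
    nlinarith [(abs_le.1 ht).1]
  -- To leading order the gap is `l * t ^ 2 / 2` and the gradient norm `l * t`, so PL reads `μ * l ≤
  -- l ^ 2` as `ε` vanishes.
  have hineq : ∀ ε > 0, μ * (l - 2 * ε) ≤ (l + ε) ^ 2 := by
    intro ε hε
    obtain ⟨t, ⟨⟨ht, ht1⟩, ht2⟩, ht0⟩ := (((hbounds ε hε).and (hsmall ε hε)).and
      ((hlineTend.eventually hPL).filter_mono nhdsWithin_le_nhds) |>.and self_mem_nhdsWithin).exists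
    have ht0 : 0 < t := ht0
    have h1 : ‖fderiv ℝ h (p + t • v)‖ ≤ (l + ε) * t := by
      have h2 : ‖t • l • innerSL ℝ v‖ = t * l := by
        rw [norm_smul, norm_smul, hnormSL, Real.norm_of_nonneg ht0.le, Real.norm_of_nonneg hl0,
          mul_one]
      calc _ = ‖(fderiv ℝ h (p + t • v) - t • l • innerSL ℝ v) + t • l • innerSL ℝ v‖ := by simp
        _ ≤ _ := norm_add_le _ _
        _ ≤ ε * t + t * l := by rw [h2]; gcongr
        _ = _ := by ring
    have h2 : ‖fderiv ℝ h (p + t • v)‖ ^ 2 ≤ ((l + ε) * t) ^ 2 :=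
      pow_le_pow_left₀ (norm_nonneg _) h1 2
    have h3 := (abs_le.1 ht).1
    have h4 : 0 < t ^ 2 := by positivity
    have h5 : μ * (l * t ^ 2 / 2 - ε * t ^ 2) ≤ μ * (h (p + t • v) - h p) :=
      mul_le_mul_of_nonneg_left (by linarith) hμ.le
    have h6 : t ^ 2 * (μ * (l - 2 * ε)) ≤ t ^ 2 * (l + ε) ^ 2 := by nlinarith
    exact le_of_mul_le_mul_left h6 h4
  have hlim : μ * l ≤ l ^ 2 := by
    have h1 : Tendsto (fun ε : ℝ => μ * (l - 2 * ε)) (𝓝[>] 0) (𝓝 (μ * l)) := by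
      have : Continuous fun ε : ℝ => μ * (l - 2 * ε) := by fun_prop
      simpa using (this.tendsto 0).mono_left nhdsWithin_le_nhds
    have h2 : Tendsto (fun ε : ℝ => (l + ε) ^ 2) (𝓝[>] 0) (𝓝 (l ^ 2)) := by
      have : Continuous fun ε : ℝ => (l + ε) ^ 2 := by fun_prop
      simpa using (this.tendsto 0).mono_left nhdsWithin_le_nhds
    exact le_of_tendsto_of_tendsto h1 h2 (eventually_mem_nhdsWithin.mono hineq)
  rcases hl0.eq_or_lt with h0 | h0
  · exact Or.inl h0.symm
  · right
    rw [sq] at hlim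
    exact le_of_mul_le_mul_right hlim h0

/-- On the orthogonal complement of its kernel, the Hessian at a minimizer satisfying a local
Polyak–Łojasiewicz inequality is bounded below by the Polyak–Łojasiewicz constant. -/
theorem mul_norm_le_norm_hessian_of_PL {E : Type*} [NormedAddCommGroup E] [InnerProductSpace ℝ E]
    [FiniteDimensional ℝ E] {h : E → ℝ} {μ : ℝ} {p w : E} (hμ : 0 < μ) (hC : ContDiff ℝ 2 h)
    (hp : p ∈ argminSet h)
    (hPL : ∀ᶠ z in 𝓝 p, 2 * μ * (h z - h p) ≤ ‖fderiv ℝ h z‖ ^ 2)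
    (hw : ∀ v, fderiv ℝ (fderiv ℝ h) p v = 0 → inner ℝ w v = 0) :
    μ * ‖w‖ ≤ ‖fderiv ℝ (fderiv ℝ h) p w‖ := by
  set H := fderiv ℝ (fderiv ℝ h) p with hH
  have hHsymm : ∀ v u, H v u = H u v := fun v u =>
    (hC.contDiffAt.isSymmSndFDerivAt (by simp)) v u
  -- The Riesz representative of the Hessian is self-adjoint, so the bound can be checked in an
  -- eigenbasis; coordinates of `w` with eigenvalue zero vanish.
  let T : E →ₗ[ℝ] E :=
    ((InnerProductSpace.toDual ℝ E).symm.toLinearEquiv.toLinearMap).comp (H : E →ₗ[ℝ] E →L[ℝ] ℝ)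
  have hT : ∀ v u, inner ℝ (T v) u = H v u := fun v u => by
    simp [T]
  have hTnorm : ∀ v, ‖T v‖ = ‖H v‖ := fun v => by simp [T]
  have hsymm : T.IsSymmetric := fun v u => by
    rw [hT, real_inner_comm, hT, hHsymm]
  set b := hsymm.eigenvectorBasis rfl with hb
  set lam := hsymm.eigenvalues rfl with hlam
  have happ : ∀ i, T (b i) = lam i • b i := fun i => by
    exact hsymm.apply_eigenvectorBasis rfl i
  have hHb : ∀ i, H (b i) = lam i • innerSL ℝ (b i) := fun i => by
    ext u
    rw [← hT, happ]
    simp [inner_smul_left]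
  have hdich : ∀ i, lam i = 0 ∨ μ ≤ lam i := fun i =>
    eigenvalue_eq_zero_or_le_of_PL hμ hC hp hPL (b.orthonormal.1 i) (hHb i)
  have hcoord : ∀ i, (μ * inner ℝ (b i) w) ^ 2 ≤ (inner ℝ (b i) (T w)) ^ 2 := fun i => by
    rw [← hsymm (b i) w, happ, inner_smul_left]
    simp only [conj_trivial]
    rcases hdich i with h0 | h0
    · have : inner ℝ (b i) w = 0 := by
        rw [real_inner_comm]; exact hw _ (by rw [hHb, h0, zero_smul])
      simp [this]
    · rw [mul_pow, mul_pow]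
      gcongr
  have hsum : (μ * ‖w‖) ^ 2 ≤ ‖T w‖ ^ 2 := by
    rw [mul_pow, ← b.sum_sq_norm_inner_right w, ← b.sum_sq_norm_inner_right (T w), Finset.mul_sum]
    refine Finset.sum_le_sum fun i _ => ?_
    simpa [mul_pow] using hcoord i
  rw [← hTnorm]
  exact le_of_sq_le_sq hsum (norm_nonneg _)

/-- Error bound at a point whose closest minimizer is `p`, with the Polyak–Łojasiewicz constant
corrected by the oscillation of the Hessian along the segment. -/
theorem mul_dist_le_norm_fderiv_of_PL {E : Type*} [NormedAddCommGroup E] [InnerProductSpace ℝ E]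
    [FiniteDimensional ℝ E] {h : E → ℝ} {μ ω : ℝ} {p x : E} (hμ : 0 < μ) (hC : ContDiff ℝ 2 h)
    (hp : p ∈ argminSet h)
    (hPL : ∀ᶠ z in 𝓝 p, 2 * μ * (h z - h p) ≤ ‖fderiv ℝ h z‖ ^ 2)
    (hclosest : ∀ z ∈ argminSet h, dist x p ≤ dist x z)
    (hosc : ∀ z ∈ segment ℝ p x, ‖fderiv ℝ (fderiv ℝ h) z - fderiv ℝ (fderiv ℝ h) p‖ ≤ ω) :
    (μ - ω) * dist x p ≤ ‖fderiv ℝ h x‖ := by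
  have hdiff2 : Differentiable ℝ (fderiv ℝ h) :=
    (hC.fderiv_right (m := 1) (by norm_num)).differentiable (by norm_num)
  have hcrit : fderiv ℝ h p = 0 := IsLocalMin.fderiv_eq_zero (Eventually.of_forall hp)
  have h1 := mul_norm_le_norm_hessian_of_PL (w := x - p) hμ hC hp hPL fun v hv => by
    refine le_antisymm (inner_nonpos_of_closest_of_PL hμ hC hp hPL hclosest hv) ?_
    have := inner_nonpos_of_closest_of_PL (v := -v) hμ hC hp hPL hclosest (by rw [map_neg, hv, neg_zero])
    rw [inner_neg_right] at this
    linarith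
  -- Mean value inequality: the gradient at `x` differs from the Hessian at `p` applied to `x - p`
  -- by at most `ω * ‖x - p‖`.
  have h2 := (convex_segment p x).norm_image_sub_le_of_norm_fderiv_le' (fun z _ => hdiff2 z) hosc
    (left_mem_segment ℝ p x) (right_mem_segment ℝ p x)
  rw [hcrit, sub_zero] at h2
  have h3 := norm_le_norm_add_norm_sub' (fderiv ℝ (fderiv ℝ h) p (x - p)) (fderiv ℝ h x)
  rw [norm_sub_rev] at h3
  rw [dist_eq_norm]
  linarith

/-! ### Connectedness of the global minimizers by a mountain pass argument -/

/-- A critical point with negative definite Hessian is a strict local maximum. -/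
theorem exists_forall_ball_lt_of_hessian_neg {E : Type*} [NormedAddCommGroup E] [NormedSpace ℝ E]
    [FiniteDimensional ℝ E] {h : E → ℝ} {q : E} (hC : ContDiff ℝ 2 h) (hcrit : fderiv ℝ h q = 0)
    (hneg : ∀ v, v ≠ 0 → fderiv ℝ (fderiv ℝ h) q v v < 0) :
    ∃ r > 0, ∀ x ∈ ball q r, x ≠ q → h x < h q := by
  have hdiff : Differentiable ℝ h := hC.differentiable (by norm_num)
  have hC1 : ContDiff ℝ 1 (fderiv ℝ h) := hC.fderiv_right (by norm_num)
  have hdiff2 : Differentiable ℝ (fderiv ℝ h) := hC1.differentiable (by norm_num)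
  have hcont2 : Continuous (fderiv ℝ (fderiv ℝ h)) := hC1.continuous_fderiv (by norm_num)
  have hcont : Continuous fun z : E × E => fderiv ℝ (fderiv ℝ h) z.1 z.2 z.2 := by fun_prop
  -- Compactness of the unit sphere makes negative definiteness an open condition on the base point.
  have hsphere : ∀ᶠ z in 𝓝 q, ∀ u ∈ sphere (0 : E) 1, fderiv ℝ (fderiv ℝ h) z u u < 0 := by
    refine (isCompact_sphere (0 : E) 1).eventually_forall_of_forall_eventually fun u hu => ?_
    exact (hcont.tendsto (q, u)).eventually_lt_const
      (hneg u (ne_zero_of_norm_ne_zero (by simp [mem_sphere_zero_iff_norm.1 hu])))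
  obtain ⟨r, hr, hball⟩ := Metric.eventually_nhds_iff_ball.1 hsphere
  refine ⟨r, hr, fun x hx hxq => ?_⟩
  set v := x - q with hv
  have hv0 : v ≠ 0 := sub_ne_zero.2 hxq
  have hmem : ∀ t ∈ Icc (0 : ℝ) 1, q + t • v ∈ ball q r := fun t ht => by
    rw [mem_ball, dist_eq_norm, add_sub_cancel_left, norm_smul, Real.norm_of_nonneg ht.1]
    rw [mem_ball, dist_eq_norm] at hx
    nlinarith [norm_nonneg v, ht.2]
  have hneg' : ∀ z ∈ ball q r, fderiv ℝ (fderiv ℝ h) z v v < 0 := fun z hz => by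
    have h1 := hball z hz (‖v‖⁻¹ • v) (by simp [norm_smul, hv0])
    have h2 : 0 < ‖v‖⁻¹ := inv_pos.2 (norm_pos_iff.2 hv0)
    simp only [map_smul, smul_apply, smul_eq_mul] at h1
    by_contra! h3
    have := mul_nonneg h2.le (mul_nonneg h2.le h3)
    linarith
  have hline : ∀ s : ℝ, HasDerivAt (fun t : ℝ => q + t • v) v s := fun s => by
    simpa using ((hasDerivAt_id s).smul_const v).const_add q
  have hφ : ∀ s : ℝ, HasDerivAt (fun t : ℝ => h (q + t • v)) (fderiv ℝ h (q + s • v) v) s :=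
    fun s => (hdiff (q + s • v)).hasFDerivAt.comp_hasDerivAt s (hline s)
  have hφ' : ∀ s : ℝ, HasDerivAt (fun t : ℝ => fderiv ℝ h (q + t • v) v)
      (fderiv ℝ (fderiv ℝ h) (q + s • v) v v) s := fun s => by
    have h1 : HasDerivAt (fun t : ℝ => fderiv ℝ h (q + t • v))
      (fderiv ℝ (fderiv ℝ h) (q + s • v) v) s :=
      (hdiff2 (q + s • v)).hasFDerivAt.comp_hasDerivAt s (hline s)
    simpa using h1.clm_apply (hasDerivAt_const s v)
  have hanti : StrictAntiOn (fun t : ℝ => fderiv ℝ h (q + t • v) v) (Icc 0 1) := by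
    refine strictAntiOn_of_deriv_neg (convex_Icc 0 1)
      (fun s _ => (hφ' s).continuousAt.continuousWithinAt) fun s hs => ?_
    rw [(hφ' s).deriv]
    exact hneg' _ (hmem s (interior_subset hs))
  have hanti' : StrictAntiOn (fun t : ℝ => h (q + t • v)) (Icc 0 1) := by
    refine strictAntiOn_of_deriv_neg (convex_Icc 0 1)
      (fun s _ => (hφ s).continuousAt.continuousWithinAt) fun s hs => ?_
    rw [(hφ s).deriv]
    have h1 := interior_subset hs
    rw [interior_Icc] at hs
    have := hanti (left_mem_Icc.2 zero_le_one) h1 hs.1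
    simpa [hcrit] using this
  simpa [hv] using hanti' (left_mem_Icc.2 zero_le_one) (right_mem_Icc.2 zero_le_one) zero_lt_one

/-- Punctured balls are connected in dimension at least two. -/
theorem isPreconnected_ball_diff_singleton {E : Type*} [NormedAddCommGroup E] [NormedSpace ℝ E]
    (hE : 1 < Module.rank ℝ E) (q : E) (r : ℝ) : IsPreconnected (ball q r \ {q}) := by
  -- Polar coordinates; the rank hypothesis makes the sphere connected.
  have himage : ball q r \ {q} =
      (fun z : ℝ × E => q + z.1 • z.2) '' (Ioo 0 r ×ˢ sphere (0 : E) 1) := by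
    ext x
    constructor
    · rintro ⟨hx, hxq⟩
      have h0 : 0 < ‖x - q‖ := norm_pos_iff.2 (sub_ne_zero.2 hxq)
      refine ⟨(‖x - q‖, ‖x - q‖⁻¹ • (x - q)), ⟨⟨h0, by rwa [← dist_eq_norm]⟩, ?_⟩, ?_⟩
      · simp [norm_smul, h0.ne']
      · simp [smul_smul, h0.ne']
    · rintro ⟨⟨t, u⟩, ⟨ht, hu⟩, rfl⟩
      have hu : ‖u‖ = 1 := mem_sphere_zero_iff_norm.1 hu
      have ht' : |t| = t := abs_of_pos ht.1
      refine ⟨by simp [dist_eq_norm, norm_smul, hu, ht', ht.2], ?_⟩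
      simp only [mem_singleton_iff, add_eq_left, smul_eq_zero, not_or]
      exact ⟨ht.1.ne', ne_zero_of_norm_ne_zero (by simp [hu])⟩
  rw [himage]
  exact (isPreconnected_Ioo.prod (isPreconnected_sphere hE 0 1)).image _ (by fun_prop)

/-- Two disjoint open sets separate `a` from `b` and cover the sublevel set of `h` at `c`. -/
def SublevelSeparates {E : Type*} [TopologicalSpace E] (h : E → ℝ) (a b : E) (c : ℝ) : Prop :=
  ∃ O O' : Set E, IsOpen O ∧ IsOpen O' ∧ Disjoint O O' ∧ a ∈ O ∧ b ∈ O' ∧ {x | h x ≤ c} ⊆ O ∪ O'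

theorem SublevelSeparates.mono {E : Type*} [TopologicalSpace E] {h : E → ℝ} {a b : E} {c c' : ℝ}
    (hs : SublevelSeparates h a b c) (hc : c' ≤ c) : SublevelSeparates h a b c' := by
  obtain ⟨O, O', h1, h2, h3, h4, h5, h6⟩ := hs
  exact ⟨O, O', h1, h2, h3, h4, h5, fun x hx => h6 (le_trans hx hc)⟩

/-- On the compact part of the sublevel set at `c + 1` missed by the two open sets, `h` attains a
minimum above `c`, so there is room to raise the level. Hence a supremum of separating levels is
never itself separating. -/
theorem SublevelSeparates.exists_gt {E : Type*} [TopologicalSpace E] {h : E → ℝ} {a b : E} {c : ℝ}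
    (hs : SublevelSeparates h a b c) (hh : Continuous h) (hK : IsCompact {x | h x ≤ c + 1}) :
    ∃ c' > c, SublevelSeparates h a b c' := by
  obtain ⟨O, O', h1, h2, h3, h4, h5, h6⟩ := hs
  rcases ({x | h x ≤ c + 1} \ (O ∪ O')).eq_empty_or_nonempty with he | hne
  · exact ⟨c + 1, by linarith, O, O', h1, h2, h3, h4, h5, sdiff_eq_empty.1 he⟩
  · obtain ⟨y, hy, hmin⟩ := (hK.diff (h1.union h2)).exists_isMinOn hne hh.continuousOn
    have hcy : c < h y := by
      by_contra! hle
      exact hy.2 (h6 hle)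
    have hy1 : h y ≤ c + 1 := hy.1
    refine ⟨(c + h y) / 2, by linarith, O, O', h1, h2, h3, h4, h5, fun x hx => ?_⟩
    have hx : h x ≤ (c + h y) / 2 := hx
    by_contra hxO
    have : h y ≤ h x := hmin ⟨show h x ≤ c + 1 by linarith, hxO⟩
    linarith

theorem SublevelSeparates.not_isPreconnected {E : Type*} [TopologicalSpace E] {h : E → ℝ} {a b : E}
    {c : ℝ} (hs : SublevelSeparates h a b c) {W : Set E} (hW : W ⊆ {x | h x ≤ c}) (ha : a ∈ W)
    (hb : b ∈ W) : ¬ IsPreconnected W := by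
  obtain ⟨O, O', h1, h2, h3, h4, h5, h6⟩ := hs
  intro hpre
  obtain ⟨z, -, hz⟩ := hpre O O' h1 h2 (hW.trans h6) ⟨a, ha, h4⟩ ⟨b, hb, h5⟩
  exact h3.le_bot hz

/-- Near a noncritical point, the points of a sublevel set can be joined to a common point inside
the open sublevel set. -/
theorem exists_preconnected_of_fderiv_ne_zero {E : Type*} [NormedAddCommGroup E] [NormedSpace ℝ E]
    {h : E → ℝ} (hC : ContDiff ℝ 1 h) {q : E} (hq : fderiv ℝ h q ≠ 0) :
    ∃ y, ∃ r > 0, ∀ x ∈ ball q r, h x ≤ h q →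
      ∃ W, IsPreconnected W ∧ W ⊆ {z | h z < h q} ∧ y ∈ W ∧ x ∈ closure W := by
  have hdiff : Differentiable ℝ h := hC.differentiable (by norm_num)
  have hcont : Continuous (fderiv ℝ h) := hC.continuous_fderiv (by norm_num)
  obtain ⟨e, he⟩ : ∃ e, fderiv ℝ h q e < 0 := by
    by_contra! hall
    refine hq (ContinuousLinearMap.ext fun v => le_antisymm ?_ (hall v))
    have := hall (-v)
    rw [map_neg] at this
    simpa using this
  have hcont' : Continuous fun z => fderiv ℝ h z e := by fun_prop
  obtain ⟨R, hR, hball⟩ := Metric.eventually_nhds_iff_ball.1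
    ((hcont'.tendsto q).eventually_lt_const he)
  obtain ⟨s, hs, hsR⟩ : ∃ s : ℝ, 0 < s ∧ s * ‖e‖ < R / 2 := by
    refine ⟨R / 2 / (‖e‖ + 1), by positivity, ?_⟩
    rw [div_mul_eq_mul_div, div_lt_iff₀ (by positivity)]
    nlinarith [norm_nonneg e]
  have hmem : ∀ x ∈ ball q (R / 2), ∀ t ∈ Icc 0 s, x + t • e ∈ ball q R := fun x hx t ht => by
    have h1 : dist (x + t • e) x ≤ s * ‖e‖ := by
      rw [dist_eq_norm, add_sub_cancel_left, norm_smul, Real.norm_of_nonneg ht.1]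
      exact mul_le_mul_of_nonneg_right ht.2 (norm_nonneg _)
    have h2 := dist_triangle (x + t • e) x q
    rw [mem_ball] at hx ⊢
    linarith
  have hline : ∀ x : E, ∀ t : ℝ, HasDerivAt (fun t : ℝ => x + t • e) e t := fun x t => by
    simpa using ((hasDerivAt_id t).smul_const e).const_add x
  have hφ : ∀ x, ∀ t : ℝ, HasDerivAt (fun t : ℝ => h (x + t • e)) (fderiv ℝ h (x + t • e) e) t :=
    fun x t => (hdiff (x + t • e)).hasFDerivAt.comp_hasDerivAt t (hline x t)
  have hdecr : ∀ x ∈ ball q (R / 2), ∀ t ∈ Ioc 0 s, h (x + t • e) < h x := fun x hx t ht => by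
    have hanti : StrictAntiOn (fun t : ℝ => h (x + t • e)) (Icc 0 s) := by
      refine strictAntiOn_of_deriv_neg (convex_Icc 0 s)
        (fun t _ => (hφ x t).continuousAt.continuousWithinAt) fun t ht => ?_
      rw [(hφ x t).deriv]
      exact hball _ (hmem x hx t (interior_subset ht))
    simpa using hanti (left_mem_Icc.2 hs.le) ⟨ht.1.le, ht.2⟩ ht.1
  have hy : ∀ᶠ z in 𝓝 (q + s • e), h z < h q :=
    (hdiff.continuous.tendsto _).eventually_lt_const
      (hdecr q (mem_ball_self (by positivity)) s ⟨hs, le_rfl⟩)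
  obtain ⟨ρ, hρ, hρball⟩ := Metric.eventually_nhds_iff_ball.1 hy
  refine ⟨q + s • e, min (R / 2) ρ, by positivity, fun x hx hxq => ?_⟩
  have hxR : x ∈ ball q (R / 2) := ball_subset_ball (min_le_left _ _) hx
  have hxρ : x ∈ ball q ρ := ball_subset_ball (min_le_right _ _) hx
  -- The descent segment from `x` omits its start, which may lie at level `h q`; it ends in a ball
  -- around the common point.
  refine ⟨(fun t : ℝ => x + t • e) '' Ioc 0 s ∪ ball (q + s • e) ρ, ?_, ?_,
    Or.inr (mem_ball_self hρ), ?_⟩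
  · refine IsPreconnected.union (x + s • e) (mem_image_of_mem _ ⟨hs, le_rfl⟩) (by simpa using hxρ)
      (isPreconnected_Ioc.image _ (by fun_prop)) isPreconnected_ball
  · rintro z (⟨t, ht, rfl⟩ | hz)
    · exact (hdecr x hxR t ht).trans_le hxq
    · exact hρball z hz
  · refine closure_mono subset_union_left (mem_closure_of_tendsto (f := fun t : ℝ => x + t • e)
      (b := 𝓝[>] 0) ?_ ?_)
    · have : Continuous fun t : ℝ => x + t • e := by fun_prop
      simpa using (this.tendsto 0).mono_left nhdsWithin_le_nhds
    · filter_upwards [Ioc_mem_nhdsGT hs] with t ht using mem_image_of_mem _ ht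

/-- Mountain pass step: if all critical points are local minimizers or strict local maximizers,
separation of the lower sublevel sets passes to their supremum. -/
theorem SublevelSeparates.of_forall_lt {E : Type*} [NormedAddCommGroup E] [NormedSpace ℝ E]
    (hE : 1 < Module.rank ℝ E) {h : E → ℝ} (hC : ContDiff ℝ 1 h)
    (hcrit : ∀ q, fderiv ℝ h q = 0 →
      IsLocalMin h q ∨ ∃ r > 0, ∀ x ∈ ball q r, x ≠ q → h x < h q)
    {a b : E} {c : ℝ} (ha : h a < c) (hb : h b < c)
    (hlt : ∀ c' < c, SublevelSeparates h a b c') : SublevelSeparates h a b c := by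
  have hcont : Continuous h := hC.continuous
  have hnt : Nontrivial E := (rank_pos_iff_nontrivial (R := ℝ)).1 (zero_lt_one.trans hE)
  set U : Set E := {z | h z < c} with hU
  have hUo : IsOpen U := isOpen_lt hcont continuous_const
  set V := connectedComponentIn U a with hV
  have hVo : IsOpen V := hUo.connectedComponentIn
  have haV : a ∈ V := mem_connectedComponentIn ha
  have hVU : V ⊆ U := connectedComponentIn_subset _ _
  have habsorb : ∀ W, IsPreconnected W → W ⊆ U → (W ∩ V).Nonempty → W ⊆ V := by
    rintro W hW hWU ⟨y, hyW, hyV⟩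
    rw [hV, connectedComponentIn_eq hyV]
    exact hW.subset_connectedComponentIn hyW hWU
  have hbV : b ∉ V := by
    intro hbV
    have hpath : IsPathConnected V :=
      hVo.isConnected_iff_isPathConnected.1 (isConnected_connectedComponentIn_iff.2 ha)
    obtain ⟨γ, hγ⟩ := hpath.joinedIn a haV b hbV
    -- The maximum of `h` on the compact path is below `c`, at a level assumed to separate.
    obtain ⟨y, ⟨t, rfl⟩, hmax⟩ := (isCompact_range γ.continuous).exists_isMaxOn (range_nonempty _)
      hcont.continuousOn
    refine (hlt (h (γ t)) (hVU (hγ t))).not_isPreconnected (W := range γ) (fun z hz => hmax hz)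
      ⟨0, γ.source⟩ ⟨1, γ.target⟩ (isPreconnected_range γ.continuous)
  have hclosL : closure V ⊆ {x | h x ≤ c} :=
    closure_minimal (fun x hx => le_of_lt (show h x < c from hVU hx)) (isClosed_le hcont continuous_const)
  -- Near `q`, all sublevel points are reachable from one point through `U`. At level `c`, a local
  -- minimizer is excluded because `V` accumulates there with smaller values; a strict local
  -- maximizer is bypassed through its connected punctured ball.
  have hacc : ∀ q ∈ closure V, ∃ y, ∃ r > 0, ∀ x ∈ ball q r, h x ≤ c →
      ∃ W, IsPreconnected W ∧ W ⊆ U ∧ y ∈ W ∧ x ∈ closure W := by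
    intro q hq
    rcases (show h q ≤ c from hclosL hq).lt_or_eq with hqc | hqc
    · obtain ⟨r, hr, hball⟩ := Metric.isOpen_iff.1 hUo q hqc
      exact ⟨q, r, hr, fun x hx _ => ⟨ball q r, isPreconnected_ball, hball, mem_ball_self hr,
        subset_closure hx⟩⟩
    · by_cases hd : fderiv ℝ h q = 0
      · rcases hcrit q hd with hmin | ⟨r, hr, hmax⟩
        · exfalso
          obtain ⟨z, hz, hzV⟩ := mem_closure_iff_nhds.1 hq _ hmin
          have h1 : h z < c := hVU hzV
          have h2 : h q ≤ h z := hz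
          linarith
        · have hcl : ball q r ⊆ closure (ball q r \ {q}) := by
            intro x hx
            have hd := (dense_compl_singleton q).open_subset_closure_inter
              (isOpen_ball (x := q) (ε := r)) hx
            rwa [← sdiff_eq] at hd
          obtain ⟨y, hy⟩ : (ball q r \ {q}).Nonempty :=
            closure_nonempty_iff.1 ⟨q, hcl (mem_ball_self hr)⟩
          exact ⟨y, r, hr, fun x hx _ => ⟨ball q r \ {q}, isPreconnected_ball_diff_singleton hE q r,
            fun z hz => (hmax z hz.1 hz.2).trans_eq hqc, hy, hcl hx⟩⟩
      · simpa only [hqc] using exists_preconnected_of_fderiv_ne_zero hC hd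
  have hopen : ∀ q ∈ closure V, ∃ r > 0, ∀ x ∈ ball q r, h x ≤ c → x ∈ closure V := by
    intro q hq
    obtain ⟨y, r, hr, hW⟩ := hacc q hq
    have hyV : y ∈ V := by
      obtain ⟨x, hxV, hxq⟩ := Metric.mem_closure_iff.1 hq r hr
      obtain ⟨W, hWc, hWU, hyW, hxW⟩ := hW x (by rwa [mem_ball, dist_comm]) (hVU hxV).le
      have hne : (W ∩ V).Nonempty := by
        rw [inter_comm]; exact mem_closure_iff.1 hxW V hVo hxV
      exact habsorb W hWc hWU hne hyW
    refine ⟨r, hr, fun x hx hxc => ?_⟩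
    obtain ⟨W, hWc, hWU, hyW, hxW⟩ := hW x hx hxc
    exact closure_mono (habsorb W hWc hWU ⟨y, hyW, hyV⟩) hxW
  -- By `hopen`, `closure V` is relatively open in the sublevel set, so both pieces are closed and
  -- normality separates them.
  have hclosed : IsClosed ({x | h x ≤ c} \ closure V) := by
    refine isClosed_of_closure_subset fun x hx => ⟨?_, fun hxV => ?_⟩
    · exact closure_minimal sdiff_subset (isClosed_le hcont continuous_const) hx
    · obtain ⟨r, hr, hball⟩ := hopen x hxV
      obtain ⟨z, hz, hzx⟩ := Metric.mem_closure_iff.1 hx r hr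
      exact hz.2 (hball z (by rwa [mem_ball, dist_comm]) hz.1)
  obtain ⟨O, O', hO, hO', h1, h2, h3⟩ := normal_separation isClosed_closure hclosed
    disjoint_sdiff_right
  refine ⟨O, O', hO, hO', h3, h1 (subset_closure haV), h2 ⟨hb.le, fun hbcl => hbV ?_⟩, fun x hx => ?_⟩
  · obtain ⟨r, hr, hball⟩ := Metric.isOpen_iff.1 hUo b hb
    refine habsorb (ball b r) isPreconnected_ball hball ?_ (mem_ball_self hr)
    exact mem_closure_iff.1 hbcl _ isOpen_ball (mem_ball_self hr)
  · by_cases hxV : x ∈ closure V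
    · exact Or.inl (h1 hxV)
    · exact Or.inr (h2 ⟨hx, hxV⟩)

/-- In dimension at least two, a coercive function all of whose critical points are local minimizers
or strict local maximizers has a connected set of global minimizers. -/
theorem isPreconnected_argminSet {E : Type*} [NormedAddCommGroup E] [NormedSpace ℝ E]
    (hE : 1 < Module.rank ℝ E) {h : E → ℝ} (hC : ContDiff ℝ 1 h)
    (hK : ∀ c, IsCompact {x | h x ≤ c})
    (hcrit : ∀ q, fderiv ℝ h q = 0 →
      IsLocalMin h q ∨ ∃ r > 0, ∀ x ∈ ball q r, x ≠ q → h x < h q) :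
    IsPreconnected (argminSet h) := by
  have hcont : Continuous h := hC.continuous
  have hclosed : IsClosed (argminSet h) := by
    simp only [argminSet, ofPred_forall]
    exact isClosed_iInter fun z => isClosed_le hcont continuous_const
  rw [isPreconnected_closed_iff]
  rintro F F' hF hF' hcover ⟨a, haS, haF⟩ ⟨b, hbS, hbF⟩
  by_contra hempty
  have hab : h b = h a := le_antisymm (hbS a) (haS b)
  have hbase : SublevelSeparates h a b (h a) := by
    obtain ⟨O, O', hO, hO', h1, h2, h3⟩ := normal_separation (hclosed.inter hF) (hclosed.inter hF')
      (by
        rw [disjoint_left]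
        exact fun z hz hz' => hempty ⟨z, hz.1, hz.2, hz'.2⟩)
    refine ⟨O, O', hO, hO', h3, h1 ⟨haS, haF⟩, h2 ⟨hbS, hbF⟩, fun x hx => ?_⟩
    have hxS : x ∈ argminSet h := fun z => le_trans hx (haS z)
    exact (hcover hxS).imp (fun hxF => h1 ⟨hxS, hxF⟩) (fun hxF => h2 ⟨hxS, hxF⟩)
  -- A disconnection of the minimizers separates at the minimum level. Separating levels are bounded
  -- because the segment from `a` to `b` is connected, and their supremum is again separating,
  -- contradicting `exists_gt`.
  set Z : Set ℝ := {c | SublevelSeparates h a b c} with hZ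
  have hbdd : BddAbove Z := by
    have hseg : IsCompact (segment ℝ a b) := by
      rw [← Path.range_segment a b]
      exact isCompact_range (Path.segment a b).continuous
    obtain ⟨y, -, hmax⟩ := hseg.exists_isMaxOn ⟨a, left_mem_segment ℝ a b⟩ hcont.continuousOn
    refine ⟨h y, fun c hc => ?_⟩
    by_contra! hlt
    exact (SublevelSeparates.mono hc hlt.le).not_isPreconnected (W := segment ℝ a b)
      (fun z hz => hmax hz) (left_mem_segment ℝ a b) (right_mem_segment ℝ a b)
      (convex_segment a b).isPreconnected
  have hsup : SublevelSeparates h a b (sSup Z) := by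
    rcases (le_csSup hbdd hbase).eq_or_lt with heq | hlt
    · rwa [← heq]
    · refine SublevelSeparates.of_forall_lt hE hC hcrit hlt (hab ▸ hlt) fun c' hc' => ?_
      obtain ⟨c, hc, hcc⟩ := exists_lt_of_lt_csSup ⟨h a, show h a ∈ Z from hbase⟩ hc'
      exact SublevelSeparates.mono hc hcc.le
  obtain ⟨c, hc, hcs⟩ := hsup.exists_gt hcont (hK _)
  exact absurd (le_csSup hbdd hcs) (not_le.2 hc)

/-! ### Local consequences of PL° -/

theorem norm_gradient_eq_norm_fderiv {E : Type*} [NormedAddCommGroup E] [InnerProductSpace ℝ E]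
    [CompleteSpace E] (h : E → ℝ) (x : E) : ‖gradient h x‖ = ‖fderiv ℝ h x‖ := by
  simp [gradient]

theorem fderiv_eq_zero_of_mem_argminSet {E : Type*} [NormedAddCommGroup E] [NormedSpace ℝ E]
    {h : E → ℝ} {x : E} (hx : x ∈ argminSet h) : fderiv ℝ h x = 0 :=
  IsLocalMin.fderiv_eq_zero (Eventually.of_forall hx)

theorem isClosed_argminSet {E : Type*} [TopologicalSpace E] {h : E → ℝ} (hh : Continuous h) :
    IsClosed (argminSet h) := by
  simp only [argminSet, ofPred_forall]
  exact isClosed_iInter fun z => isClosed_le hh continuous_const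

/-- The PL° condition gives the Polyak–Łojasiewicz inequality near every global minimizer. -/
theorem IsPLCirc.eventually_PL {d : ℕ} {μ : ℝ} {h : EuclideanSpace ℝ (Fin d) → ℝ} (hμ : 0 < μ)
    (hPL : IsPLCirc μ h) {p : EuclideanSpace ℝ (Fin d)} (hp : p ∈ argminSet h) :
    ∀ᶠ z in 𝓝 p, 2 * μ * (h z - h p) ≤ ‖fderiv ℝ h z‖ ^ 2 := by
  obtain ⟨-, ⟨N, hN, -⟩, -⟩ := hPL
  have hpM : p ∈ localMinSet h := Eventually.of_forall hp
  obtain ⟨hNo, hCN, ⟨m, ⟨⟨y, -, hy⟩, hm⟩, hineq⟩, -⟩ := hN _ ⟨p, hpM, rfl⟩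
  have hpN := hCN (mem_connectedComponentIn hpM)
  have hmp : m = h p := le_antisymm (hm (mem_image_of_mem h hpN)) (hy ▸ hp y)
  filter_upwards [hNo.mem_nhds hpN] with z hz
  have h1 := hineq z hz
  rw [norm_gradient_eq_norm_fderiv, hmp, ← div_eq_inv_mul, le_div_iff₀ (by positivity)] at h1
  linarith

/-- Under the PL° condition every critical point is a local minimizer or a strict local
maximizer. -/
theorem IsPLCirc.isLocalMin_or_lt {d : ℕ} {μ : ℝ} {h : EuclideanSpace ℝ (Fin d) → ℝ}
    (hPL : IsPLCirc μ h) {q : EuclideanSpace ℝ (Fin d)} (hq : fderiv ℝ h q = 0) :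
    IsLocalMin h q ∨ ∃ r > 0, ∀ x ∈ ball q r, x ≠ q → h x < h q := by
  obtain ⟨hC, ⟨N, hN, hneg⟩, -⟩ := hPL
  by_cases hmem : q ∈ ⋃ C ∈ componentsOf (localMinSet h), N C
  · left
    obtain ⟨C, hC, hqC⟩ := mem_iUnion₂.1 hmem
    obtain ⟨hNo, -, ⟨m, ⟨-, hm⟩, hineq⟩, -⟩ := hN C hC
    filter_upwards [hNo.mem_nhds hqC] with z hz
    -- With zero gradient, PL forces `h q` to be the minimum over the neighbourhood.
    have h1 := hineq q hqC
    rw [norm_gradient_eq_norm_fderiv, hq, norm_zero] at h1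
    have h2 := hm (mem_image_of_mem h hz)
    linarith
  · exact Or.inr (exists_forall_ball_lt_of_hessian_neg hC hq
      (hneg q hmem (by simp [gradient, hq])))

/-- Uniform continuity on a compact set, in terms of the norm. -/
theorem IsCompact.exists_forall_norm_sub_lt {X F : Type*} [PseudoMetricSpace X]
    [NormedAddCommGroup F] {K : Set X} (hK : IsCompact K) {f : X → F} (hf : ContinuousOn f K)
    {ω : ℝ} (hω : 0 < ω) :
    ∃ δ > 0, ∀ x ∈ K, ∀ y ∈ K, dist x y < δ → ‖f x - f y‖ < ω := by
  simpa only [dist_eq_norm] using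
    Metric.uniformContinuousOn_iff.1 (hK.uniformContinuousOn_of_continuous hf) ω hω

/-! ### Local stability of the solution sets -/

section LowerLevel

variable {m d : ℕ} {Θ : Set (EuclideanSpace ℝ (Fin m))}
  {g : EuclideanSpace ℝ (Fin m) → EuclideanSpace ℝ (Fin d) → ℝ}
  {μ L Cg Dg μqg D : ℝ} {ng : ℕ}

theorem LowerLevelRegular.isCompact_argminSet (hreg : LowerLevelRegular Θ g L Cg Dg ng μqg D)
    {θ : EuclideanSpace ℝ (Fin m)} (hθ : θ ∈ Θ) (hC : Continuous (g θ)) :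
    IsCompact (argminSet (g θ)) :=
  (isCompact_closedBall 0 D).of_isClosed_subset (isClosed_argminSet hC) (hreg.subset_ball θ hθ)

/-- Quadratic growth makes the sublevel sets compact. -/
theorem LowerLevelRegular.isCompact_sublevel (hreg : LowerLevelRegular Θ g L Cg Dg ng μqg D)
    (hμqg : 0 < μqg) {θ : EuclideanSpace ℝ (Fin m)} (hθ : θ ∈ Θ) (hC : Continuous (g θ)) (c : ℝ) :
    IsCompact {x | g θ x ≤ c} := by
  obtain ⟨z, hz⟩ := hreg.nonempty θ hθ
  refine Metric.isCompact_of_isClosed_isBounded (isClosed_le hC continuous_const)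
    (isBounded_closedBall (x := 0) (r := D + √(2 * (c - g θ z) / μqg)) |>.subset fun x hx => ?_)
  rw [mem_closedBall_zero_iff]
  rcases le_total ‖x‖ D with hxD | hxD
  · exact hxD.trans (le_add_of_nonneg_right (Real.sqrt_nonneg _))
  · have h1 := hreg.quadratic_growth θ hθ x hxD z hz
    have hx : g θ x ≤ c := hx
    have h2 : ‖x‖ - D ≤ infDist x (argminSet (g θ)) := by
      refine (le_infDist ⟨z, hz⟩).2 fun y hy => ?_
      have h3 := mem_closedBall_zero_iff.1 (hreg.subset_ball θ hθ hy)
      have h4 := norm_sub_norm_le x y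
      rw [dist_eq_norm]
      linarith
    have h5 : infDist x (argminSet (g θ)) ≤ √(2 * (c - g θ z) / μqg) := by
      refine Real.le_sqrt_of_sq_le ?_
      rw [le_div_iff₀ hμqg]
      linarith
    linarith

/-- The mountain pass argument needs `d ≥ 2`: on a line, removing a strict local maximizer
disconnects its neighbourhood. -/
theorem LowerLevelRegular.isPreconnected_argminSet
    (hreg : LowerLevelRegular Θ g L Cg Dg ng μqg D) (hμqg : 0 < μqg)
    (hPL : ∀ θ ∈ Θ, IsPLCirc μ (g θ))
    (hd : d = 1 → ∀ θ ∈ Θ, IsPreconnected (argminSet (g θ)))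
    {θ : EuclideanSpace ℝ (Fin m)} (hθ : θ ∈ Θ) : IsPreconnected (argminSet (g θ)) := by
  obtain rfl | rfl | hd2 : d = 0 ∨ d = 1 ∨ 1 < d := by omega
  · exact Set.Subsingleton.isPreconnected (subsingleton_of_subsingleton)
  · exact hd rfl θ hθ
  · refine _root_.isPreconnected_argminSet ?_ ((hPL θ hθ).1.of_le (by norm_num))
      (hreg.isCompact_sublevel hμqg hθ (hPL θ hθ).1.continuous)
      fun q hq => (hPL θ hθ).isLocalMin_or_lt hq
    exact Module.one_lt_rank_of_one_lt_finrank (by simpa using hd2)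

/-- Error bound on a tube around the minimizers whose radius does not depend on the parameter. -/
theorem LowerLevelRegular.exists_error_bound (hreg : LowerLevelRegular Θ g L Cg Dg ng μqg D)
    (hΘ : IsCompact Θ) (hμ : 0 < μ) (hPL : ∀ θ ∈ Θ, IsPLCirc μ (g θ)) {ω : ℝ} (hω : 0 < ω) :
    ∃ r > 0, ∀ θ ∈ Θ, ∀ x, infDist x (argminSet (g θ)) < r →
      (μ - ω) * infDist x (argminSet (g θ)) ≤ ‖fderiv ℝ (g θ) x‖ := by
  obtain ⟨δ, hδ, hδH⟩ := IsCompact.exists_forall_norm_sub_lt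
    (F := EuclideanSpace ℝ (Fin d) →L[ℝ] EuclideanSpace ℝ (Fin d) →L[ℝ] ℝ)
    (f := fun p : EuclideanSpace ℝ (Fin m) × EuclideanSpace ℝ (Fin d) =>
      fderiv ℝ (fderiv ℝ (g p.1)) p.2)
    (hΘ.prod (isCompact_closedBall (0 : EuclideanSpace ℝ (Fin d)) (D + 1)))
    (hreg.hessian_cont.mono (prod_mono Subset.rfl (subset_univ _))) hω
  -- The bound `1` keeps the segment to the closest minimizer in the ball of radius `D + 1`, where
  -- `δ` controls the Hessian.
  refine ⟨min δ 1, by positivity, fun θ hθ x hx => ?_⟩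
  have hC := (hPL θ hθ).1
  obtain ⟨p, hp, hpx⟩ := (hreg.isCompact_argminSet hθ hC.continuous).exists_infDist_eq_dist
    (hreg.nonempty θ hθ) x
  rw [hpx] at hx ⊢
  refine mul_dist_le_norm_fderiv_of_PL hμ hC hp ((hPL θ hθ).eventually_PL hμ hp)
    (fun z hz => hpx ▸ infDist_le_dist_of_mem hz) fun z hz => ?_
  have hzp : dist z p ≤ dist x p := by
    have := segment_subset_closedBall_left p x hz
    rwa [mem_closedBall, dist_comm p x] at this
  have hpD := mem_closedBall_zero_iff.1 (hreg.subset_ball θ hθ hp)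
  have hzD : ‖z‖ ≤ D + 1 := by
    have h1 := norm_le_norm_add_norm_sub' z p
    rw [← dist_eq_norm] at h1
    have h2 := hx.trans_le (min_le_right _ _)
    linarith
  have := hδH (θ, z) ⟨hθ, mem_closedBall_zero_iff.2 hzD⟩ (θ, p)
    ⟨hθ, mem_closedBall_zero_iff.2 (by linarith)⟩ (by
      rw [dist_prod_same_left]
      exact hzp.trans_lt (hx.trans_le (min_le_left _ _)))
  exact this.le

/-- Upper semicontinuity of the solution map. -/
theorem LowerLevelRegular.eventually_infDist_lt (hreg : LowerLevelRegular Θ g L Cg Dg ng μqg D)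
    {θ₀ : EuclideanSpace ℝ (Fin m)} (hθ₀ : θ₀ ∈ Θ) {r : ℝ}
    (hr : 0 < r) :
    ∀ᶠ θ in 𝓝[Θ] θ₀, ∀ y ∈ argminSet (g θ), infDist y (argminSet (g θ₀)) < r := by
  have hK : IsCompact (closedBall (0 : EuclideanSpace ℝ (Fin d)) D ∩
      {y | r ≤ infDist y (argminSet (g θ₀))}) :=
    (isCompact_closedBall 0 D).inter_right (isClosed_le continuous_const (continuous_infDist_pt _))
  obtain ⟨z, hz⟩ := hreg.nonempty θ₀ hθ₀
  -- The strict inequality `g θ₀ z < g θ₀ y` persists near `(θ₀, y)`; compactness makes the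
  -- parameter neighbourhood uniform in `y`.
  have hev : ∀ᶠ θ in 𝓝 θ₀, ∀ y ∈ closedBall (0 : EuclideanSpace ℝ (Fin d)) D ∩
      {y | r ≤ infDist y (argminSet (g θ₀))}, y ∉ argminSet (g θ) := by
    refine hK.eventually_forall_of_forall_eventually fun y hy => ?_
    have hyS : y ∉ argminSet (g θ₀) := fun hyS => by
      have := hy.2
      rw [mem_ofPred_eq, infDist_zero_of_mem hyS] at this
      linarith
    have hlt : g θ₀ z < g θ₀ y := by
      by_contra! hle
      exact hyS fun w => hle.trans (hz w)
    have hy1 : Tendsto (fun q : EuclideanSpace ℝ (Fin m) × EuclideanSpace ℝ (Fin d) => g q.1 q.2)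
        (𝓝 (θ₀, y)) (𝓝 (g θ₀ y)) := (hreg.contDiff θ₀ hθ₀ y).continuousAt
    have hz1 : Tendsto (fun q : EuclideanSpace ℝ (Fin m) × EuclideanSpace ℝ (Fin d) => g q.1 z)
        (𝓝 (θ₀, y)) (𝓝 (g θ₀ z)) := by
      have h1 : Tendsto (fun q : EuclideanSpace ℝ (Fin m) × EuclideanSpace ℝ (Fin d) => (q.1, z))
        (𝓝 (θ₀, y)) (𝓝 (θ₀, z)) := (by fun_prop : Continuous fun
          q : EuclideanSpace ℝ (Fin m) × EuclideanSpace ℝ (Fin d) => (q.1, z)).tendsto (θ₀, y)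
      exact (hreg.contDiff θ₀ hθ₀ z).continuousAt.tendsto.comp h1
    filter_upwards [hz1.eventually_lt hy1 hlt] with q hq hqS
    exact absurd (hqS z) (not_le.2 hq)
  filter_upwards [hev.filter_mono nhdsWithin_le_nhds, self_mem_nhdsWithin] with θ hθ hθΘ y hy
  by_contra! hle
  exact hθ y ⟨hreg.subset_ball θ hθΘ hy, hle⟩ hy

/-- A minimizer for one parameter is almost critical for another one. -/
theorem LowerLevelRegular.norm_fderiv_le (hreg : LowerLevelRegular Θ g L Cg Dg ng μqg D)
    {θ θ' : EuclideanSpace ℝ (Fin m)} (hθ : θ ∈ Θ) (hθ' : θ' ∈ Θ) {x : EuclideanSpace ℝ (Fin d)}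
    (hx : x ∈ argminSet (g θ)) : ‖fderiv ℝ (g θ') x‖ ≤ L * ‖θ' - θ‖ := by
  have h1 := hreg.smooth x (mem_closedBall_zero_iff.1 (hreg.subset_ball θ hθ hx)) θ' hθ' θ hθ
  have h2 : gradient (g θ) x = 0 := by simp [gradient, fderiv_eq_zero_of_mem_argminSet hx]
  rwa [h2, sub_zero, norm_gradient_eq_norm_fderiv] at h1

/-- Pointwise Lipschitz estimate for the solution map. -/
theorem LowerLevelRegular.eventually_hausdorffDist_le
    (hreg : LowerLevelRegular Θ g L Cg Dg ng μqg D) (hΘ : IsCompact Θ) (hμ : 0 < μ)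
    (hμqg : 0 < μqg) (hPL : ∀ θ ∈ Θ, IsPLCirc μ (g θ))
    (hd : d = 1 → ∀ θ ∈ Θ, IsPreconnected (argminSet (g θ)))
    {θ₀ : EuclideanSpace ℝ (Fin m)} (hθ₀ : θ₀ ∈ Θ) {ε : ℝ} (hε : 0 < ε) :
    ∀ᶠ θ in 𝓝[Θ] θ₀,
      hausdorffDist (argminSet (g θ₀)) (argminSet (g θ)) ≤ (L / μ + ε) * ‖θ - θ₀‖ := by
  obtain ⟨ω, ⟨hωμ, hωL⟩, hω⟩ : ∃ ω, (ω < μ ∧ L / (μ - ω) < L / μ + ε) ∧ 0 < ω := by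
    have htend : Tendsto (fun ω : ℝ => L / (μ - ω)) (𝓝 0) (𝓝 (L / μ)) := by
      have : ContinuousAt (fun ω : ℝ => L / (μ - ω)) 0 :=
        continuousAt_const.div (continuousAt_const.sub continuousAt_id) (by simpa using hμ.ne')
      simpa using this.tendsto
    exact ((((eventually_lt_nhds hμ).and
      (htend.eventually_lt_const (by linarith))).filter_mono nhdsWithin_le_nhds).and
      (self_mem_nhdsWithin : Ioi (0 : ℝ) ∈ 𝓝[>] 0)).exists
  have hω' : 0 < μ - ω := sub_pos.2 hωμ
  obtain ⟨r, hr, hbound⟩ := hreg.exists_error_bound hΘ hμ hPL hω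
  have hsmall : ∀ᶠ θ in 𝓝[Θ] θ₀, L / (μ - ω) * ‖θ - θ₀‖ < r := by
    have : Continuous fun θ => L / (μ - ω) * ‖θ - θ₀‖ := by fun_prop
    exact ((this.tendsto θ₀).eventually_lt_const (by simpa using hr)).filter_mono nhdsWithin_le_nhds
  filter_upwards [hsmall, hreg.eventually_infDist_lt hθ₀ hr, self_mem_nhdsWithin]
    with θ hθr husc hθ
  set ρ := L / (μ - ω) * ‖θ - θ₀‖ with hρ
  obtain ⟨y, hy⟩ := hreg.nonempty θ hθ
  have hρL : ∀ s, (μ - ω) * s ≤ L * ‖θ - θ₀‖ → s ≤ ρ := fun s hs => by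
    rw [hρ, div_mul_eq_mul_div, le_div_iff₀ hω']
    linarith
  have hle₀ : ∀ y ∈ argminSet (g θ), infDist y (argminSet (g θ₀)) ≤ ρ := fun y hy => by
    refine hρL _ ((hbound θ₀ hθ₀ y (husc y hy)).trans ?_)
    rw [norm_sub_rev]
    exact hreg.norm_fderiv_le hθ hθ₀ hy
  have hle : ∀ x ∈ argminSet (g θ₀), infDist x (argminSet (g θ)) < r →
      infDist x (argminSet (g θ)) ≤ ρ := fun x hx hxr =>
    hρL _ ((hbound θ hθ x hxr).trans (hreg.norm_fderiv_le hθ₀ hθ hx))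
  -- Distances to the new solution set are at most `ρ` or at least `r`, with `ρ < r`. Upper
  -- semicontinuity supplies one point of the first kind, so connectedness excludes the second.
  have hfar : ∀ x ∈ argminSet (g θ₀), infDist x (argminSet (g θ)) < r := by
    by_contra! hex
    obtain ⟨x, hx, hxr⟩ := hex
    obtain ⟨x', hx', hx'r⟩ := (infDist_lt_iff (hreg.nonempty θ₀ hθ₀)).1 (husc y hy)
    have hconn := isPreconnected_closed_iff.1 (hreg.isPreconnected_argminSet hμqg hPL hd hθ₀)
      {x | infDist x (argminSet (g θ)) ≤ ρ} {x | r ≤ infDist x (argminSet (g θ))}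
      (isClosed_le (continuous_infDist_pt _) continuous_const)
      (isClosed_le continuous_const (continuous_infDist_pt _))
      (fun z hz => (lt_or_ge (infDist z (argminSet (g θ))) r).imp (hle z hz) id)
      ⟨x', hx', hle x' hx' ((infDist_le_dist_of_mem hy).trans_lt (by rwa [dist_comm]))⟩
      ⟨x, hx, hxr⟩
    obtain ⟨z, -, hz1, hz2⟩ := hconn
    have hz1 : infDist z (argminSet (g θ)) ≤ ρ := hz1
    have hz2 : r ≤ infDist z (argminSet (g θ)) := hz2
    linarith
  refine (hausdorffDist_le_of_infDist (infDist_nonneg.trans (hle₀ y hy))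
    (fun x hx => hle x hx (hfar x hx)) hle₀).trans ?_
  exact mul_le_mul_of_nonneg_right hωL.le (norm_nonneg _)

end LowerLevel

/-! ### Integration along segments -/

/-- A function on the unit interval with pointwise Lipschitz constant `K` grows by at most `K`. -/
theorem sub_le_of_eventually_abs_sub_le {φ : ℝ → ℝ} {K : ℝ}
    (hφ : ∀ t ∈ Icc (0 : ℝ) 1, ∀ ε > 0, ∀ᶠ s in 𝓝[Icc 0 1] t, |φ s - φ t| ≤ (K + ε) * |s - t|) :
    φ 1 - φ 0 ≤ K := by
  have hcont : ContinuousOn φ (Icc 0 1) := fun t ht => by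
    have h0 : Tendsto (fun s => (K + 1) * |s - t|) (𝓝[Icc 0 1] t) (𝓝 0) := by
      have : Continuous fun s => (K + 1) * |s - t| := by fun_prop
      simpa using (this.tendsto t).mono_left nhdsWithin_le_nhds
    refine tendsto_iff_dist_tendsto_zero.2 (squeeze_zero' (Eventually.of_forall fun _ => dist_nonneg)
      ?_ h0)
    simpa [Real.dist_eq] using hφ t ht 1 one_pos
  have := image_le_of_liminf_slope_right_le_deriv_boundary (B := fun t => φ 0 + K * t)
    (B' := fun _ => K) hcont (by simp) (by fun_prop)
    (fun t _ => by
      simpa using (((hasDerivAt_id t).const_mul K).const_add (φ 0)).hasDerivWithinAt)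
    (fun t ht r hr => by
      -- Half the gap `r - K` leaves the slope strictly below `r`.
      have h1 := hφ t (Ico_subset_Icc_self ht) ((r - K) / 2) (by linarith)
      have h2 : 𝓝[>] t ≤ 𝓝[Icc 0 1] t :=
        nhdsWithin_le_of_mem (mem_of_superset (Ioc_mem_nhdsGT ht.2) fun s hs =>
          ⟨ht.1.trans hs.1.le, hs.2⟩)
      refine Eventually.frequently ?_
      filter_upwards [h1.filter_mono h2, self_mem_nhdsWithin] with s hs hst
      have hst : 0 < s - t := sub_pos.2 hst
      rw [slope_def_field, div_lt_iff₀ hst]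
      rw [abs_of_pos hst] at hs
      nlinarith [le_abs_self (φ s - φ t)])
    (right_mem_Icc.2 zero_le_one)
  simp only [mul_one] at this
  linarith

/-- The local estimates hold on neighbourhoods of unknown size, but by the triangle inequality the
distance from the first solution set, followed along the segment, inherits their pointwise constant.
-/
theorem LowerLevelRegular.hausdorffDist_argminSet_le {m d : ℕ}
    {Θ : Set (EuclideanSpace ℝ (Fin m))}
    {g : EuclideanSpace ℝ (Fin m) → EuclideanSpace ℝ (Fin d) → ℝ}
    {μ L Cg Dg μqg D : ℝ} {ng : ℕ} (hreg : LowerLevelRegular Θ g L Cg Dg ng μqg D)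
    (hΘ : IsCompact Θ) (hconv : Convex ℝ Θ) (hμ : 0 < μ)
    (hμqg : 0 < μqg) (hPL : ∀ θ ∈ Θ, IsPLCirc μ (g θ))
    (hd : d = 1 → ∀ θ ∈ Θ, IsPreconnected (argminSet (g θ)))
    {θ₁ θ₂ : EuclideanSpace ℝ (Fin m)} (h₁ : θ₁ ∈ Θ) (h₂ : θ₂ ∈ Θ) :
    hausdorffDist (argminSet (g θ₁)) (argminSet (g θ₂)) ≤ L / μ * ‖θ₁ - θ₂‖ := by
  have hfin : ∀ θ ∈ Θ, ∀ θ' ∈ Θ, hausdorffEDist (argminSet (g θ)) (argminSet (g θ')) ≠ ⊤ :=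
    fun θ hθ θ' hθ' => hausdorffEDist_ne_top_of_nonempty_of_bounded (hreg.nonempty θ hθ)
      (hreg.nonempty θ' hθ') (isBounded_closedBall.subset (hreg.subset_ball θ hθ))
      (isBounded_closedBall.subset (hreg.subset_ball θ' hθ'))
  set γ : ℝ → EuclideanSpace ℝ (Fin m) := fun t => θ₁ + t • (θ₂ - θ₁) with hγ
  have hγΘ : MapsTo γ (Icc 0 1) Θ := fun t ht => hconv.add_smul_sub_mem h₁ h₂ ht
  have hγc : Continuous γ := by fun_prop
  have hγd : ∀ s t, ‖γ s - γ t‖ = |s - t| * ‖θ₁ - θ₂‖ := fun s t => by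
    rw [hγ, norm_sub_rev θ₁]
    simp only [add_sub_add_left_eq_sub, ← sub_smul, norm_smul, Real.norm_eq_abs]
  have key := sub_le_of_eventually_abs_sub_le (K := L / μ * ‖θ₁ - θ₂‖)
    (φ := fun t => hausdorffDist (argminSet (g θ₁)) (argminSet (g (γ t)))) fun t ht ε hε => by
    have hloc := hreg.eventually_hausdorffDist_le hΘ hμ hμqg hPL hd (hγΘ ht)
      -- The `+ 1` covers `θ₁ = θ₂`; after rescaling by the segment length the error is at most `ε`.
      (ε := ε / (‖θ₁ - θ₂‖ + 1)) (by positivity)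
    have htend : Tendsto γ (𝓝[Icc 0 1] t) (𝓝[Θ] (γ t)) :=
      hγc.continuousWithinAt.tendsto_nhdsWithin hγΘ
    filter_upwards [htend.eventually hloc, self_mem_nhdsWithin] with s hs hsI
    have h1 := hausdorffDist_triangle (u := argminSet (g (γ s))) (hfin θ₁ h₁ _ (hγΘ ht))
    have h2 := hausdorffDist_triangle (u := argminSet (g (γ t))) (hfin θ₁ h₁ _ (hγΘ hsI))
    rw [hausdorffDist_comm (s := argminSet (g (γ s))) (t := argminSet (g (γ t)))] at h2
    rw [hγd] at hs
    have h3 : ε / (‖θ₁ - θ₂‖ + 1) * ‖θ₁ - θ₂‖ ≤ ε := by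
      rw [div_mul_eq_mul_div, div_le_iff₀ (by positivity)]
      nlinarith [norm_nonneg (θ₁ - θ₂)]
    have h4 := mul_le_mul_of_nonneg_right h3 (abs_nonneg (s - t))
    rw [abs_le]
    constructor <;> nlinarith
  simpa [hγ] using key

end

theorem mainTheorem6 {m d : ℕ} (Θ : Set (EuclideanSpace ℝ (Fin m)))
    (hΘ_compact : IsCompact Θ) (hΘ_convex : Convex ℝ Θ)
    (g : EuclideanSpace ℝ (Fin m) → EuclideanSpace ℝ (Fin d) → ℝ)
    (μ L Cg Dg μqg D : ℝ) (ng : ℕ)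
    (hμ : 0 < μ) (hCg : 0 ≤ Cg) (hDg : 0 ≤ Dg) (hng : 1 ≤ ng) (hμqg : 0 < μqg) (hD : 0 < D)
    (hPL : ∀ θ ∈ Θ, IsPLCirc μ (g θ))
    (hreg : LowerLevelRegular Θ g L Cg Dg ng μqg D)
    (hd : d = 1 → ∀ θ ∈ Θ, IsPreconnected (argminSet (g θ))) :
    ∃ γ : ℝ, 0 < γ ∧ ∀ θ₁ ∈ Θ, ∀ θ₂ ∈ Θ, ‖θ₁ - θ₂‖ ≤ γ →
      Metric.hausdorffDist (argminSet (g θ₁)) (argminSet (g θ₂)) ≤ L / μ * ‖θ₁ - θ₂‖ := by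
  -- The estimate holds for all pairs in `Θ`, so any positive radius would do.
  exact ⟨1, one_pos, fun θ₁ h₁ θ₂ h₂ _ =>
    hreg.hausdorffDist_argminSet_le hΘ_compact hΘ_convex hμ hμqg hPL hd h₁ h₂⟩
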